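/- Let $Prop$ be a countably infinite set of propositional variables and let $Form$ be the set of formulas generated by $\varphi ::= p\in Prop \mid \top \mid \bot \mid \varphi\wedge\varphi \mid \varphi\vee\varphi \mid \varphi\to\varphi \mid \varphi\prec\varphi$, with the abbreviations $\neg\varphi := \varphi\to\bot$ and ${\sim}\varphi := \top\prec\varphi$. Weak bi-intuitionistic logic $\mathsf{wBIL}$ is the consequence relation $\Gamma\vdash_w\varphi$ (for arbitrary sets $\Gamma\subseteq Form$ and $\varphi\in Form$) given by the following calculus. The axioms are all instances of - $\varphi\to(\psi\to\varphi)$ and $(\varphi\to(\psi\to\chi))\to((\varphi\to\psi)\to(\varphi\to\chi))$; - $\varphi\to(\varphi\vee\psi)$, $\psi\to(\varphi\vee\psi)$ and $(\varphi\to\chi)\to((\psi\to\chi)\to((\varphi\vee\psi)\to\chi))$; - $(\varphi\wedge\psi)\to\varphi$, $(\varphi\wedge\psi)\to\psi$ and $(\chi\to\varphi)\to((\chi\to\psi)\to(\chi\to(\varphi\wedge\psi)))$; - $\bot\to\varphi$ and $\varphi\to\top$; - $\varphi\to(\psi\vee(\varphi\prec\psi))$ and $(\varphi\prec\psi)\to{\sim}(\varphi\to\psi)$;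 - $((\varphi\prec\psi)\prec\chi)\to(\varphi\prec(\psi\vee\chi))$ and $\neg(\varphi\prec\psi)\to(\varphi\to\psi)$. The rules are: $\Gamma\vdash_w\varphi$ if $\varphi$ is an axiom or $\varphi\in\Gamma$; from $\Gamma\vdash_w\varphi$ and $\Gamma\vdash_w\varphi\to\psi$ infer $\Gamma\vdash_w\psi$; and from $\emptyset\vdash_w\varphi$ infer $\Gamma\vdash_w\neg{\sim}\varphi$. A bi-Heyting algebra is a bounded lattice with binary operations $\to$ and $\prec$ such that $a\wedge b\le c \iff a\le b\to c$ and $a\le b\vee c \iff a\prec b\le c$ for all $a,b,c$. Let $\mathcal{BHA}$ be the class of all bi-Heyting algebras. An equation is a pair of formulas, written $\varphi=\psi$. For sets of equations $\Theta,\Theta'$, write $\Theta\vDash_{\mathcal{BHA}}\Theta'$ if, for every algebra in $\mathcal{BHA}$ and every valuation of $Prop$ in it, whenever all equations of $\Theta$ hold under the valuation, so do all equations of $\Theta'$. For a set $\tau(x)$ of equations in which no variable other than $x$ occurs, let $\tau(\varphi)$ be the set obtained by replacing $x$ by $\varphi$ in all its equations, and let $\tau(\Gamma)=\bigcup_{\gamma\in\Gamma}\tau(\gamma)$.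 **Theorem.** There is no set $\tau(x)$ of equations in one variable for which $\mathcal{BHA}$ is a $\tau(x)$-algebraic semantics of $\mathsf{wBIL}$; that is, there is no $\tau(x)$ such that for all $\Gamma\subseteq Form$ and $\varphi\in Form$, $$\Gamma\vdash_w\varphi \iff \tau(\Gamma)\vDash_{\mathcal{BHA}}\tau(\varphi).$$ -/

import Mathlib

universe u

namespace BiInt

/-- Formulas of the bi-intuitionistic language; the countably infinite set of
propositional variables is `ℕ`. `excl φ ψ` is read "`φ` excludes `ψ`". -/
inductive Form : Type
  | var : ℕ → Form
  | top : Form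
  | bot : Form
  | and : Form → Form → Form
  | or : Form → Form → Form
  | imp : Form → Form → Form
  | excl : Form → Form → Form

namespace Form

/-- Negation `¬φ := φ → ⊥`. -/
def neg (φ : Form) : Form := imp φ bot

/-- Co-negation (weak negation) `∼φ := ⊤ excl φ`. -/
def coneg (φ : Form) : Form := excl top φ

/-- The set of propositional variables that occur in a formula. -/
def vars : Form → Set ℕ
  | var p => {p}
  | top => ∅
  | bot => ∅
  | and φ ψ => φ.vars ∪ ψ.vars
  | or φ ψ => φ.vars ∪ ψ.vars
  | imp φ ψ => φ.vars ∪ ψ.vars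
  | excl φ ψ => φ.vars ∪ ψ.vars

/-- `replace x φ χ` is the formula `φ` with every occurrence of the variable `x` replaced
by the formula `χ`. -/
def replace (x : ℕ) : Form → Form → Form
  | var p, χ => if p = x then χ else var p
  | top, _ => top
  | bot, _ => bot
  | and φ ψ, χ => and (replace x φ χ) (replace x ψ χ)
  | or φ ψ, χ => or (replace x φ χ) (replace x ψ χ)
  | imp φ ψ, χ => imp (replace x φ χ) (replace x ψ χ)
  | excl φ ψ, χ => excl (replace x φ χ) (replace x ψ χ)

end Form

open Form in
/-- The instances of the axioms of the Hilbert calculus of weak bi-intuitionistic logic. -/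
inductive IsAxiom : Form → Prop
  | a1 (φ ψ : Form) : IsAxiom (imp φ (imp ψ φ))
  | a2 (φ ψ χ : Form) : IsAxiom (imp (imp φ (imp ψ χ)) (imp (imp φ ψ) (imp φ χ)))
  | a3 (φ ψ : Form) : IsAxiom (imp φ (or φ ψ))
  | a4 (φ ψ : Form) : IsAxiom (imp ψ (or φ ψ))
  | a5 (φ ψ χ : Form) : IsAxiom (imp (imp φ χ) (imp (imp ψ χ) (imp (or φ ψ) χ)))
  | a6 (φ ψ : Form) : IsAxiom (imp (and φ ψ) φ)
  | a7 (φ ψ : Form) : IsAxiom (imp (and φ ψ) ψ)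
  | a8 (φ ψ χ : Form) : IsAxiom (imp (imp χ φ) (imp (imp χ ψ) (imp χ (and φ ψ))))
  | a9 (φ : Form) : IsAxiom (imp bot φ)
  | a10 (φ : Form) : IsAxiom (imp φ top)
  | a11 (φ ψ : Form) : IsAxiom (imp φ (or ψ (excl φ ψ)))
  | a12 (φ ψ : Form) : IsAxiom (imp (excl φ ψ) (coneg (imp φ ψ)))
  | a13 (φ ψ χ : Form) : IsAxiom (imp (excl (excl φ ψ) χ) (excl φ (or ψ χ)))
  | a14 (φ ψ : Form) : IsAxiom (imp (neg (excl φ ψ)) (imp φ ψ))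

/-- The consequence relation `Γ ⊢ φ` of weak bi-intuitionistic logic wBIL, given by its
generalised Hilbert calculus. The premise of the rule `wDN` has an empty context. -/
inductive WBIL : Set Form → Form → Prop
  | ax (Γ : Set Form) (φ : Form) (h : IsAxiom φ) : WBIL Γ φ
  | el (Γ : Set Form) (φ : Form) (h : φ ∈ Γ) : WBIL Γ φ
  | mp (Γ : Set Form) (φ ψ : Form) (h₁ : WBIL Γ φ) (h₂ : WBIL Γ (Form.imp φ ψ)) : WBIL Γ ψ
  | wDN (Γ : Set Form) (φ : Form) (h : WBIL ∅ φ) : WBIL Γ (Form.neg (Form.coneg φ))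

/-- Algebras of the type of the bi-intuitionistic language: a set with two constants and
four binary operations, subject to no laws. -/
structure Alg : Type (u + 1) where
  carrier : Type u
  top : carrier
  bot : carrier
  and : carrier → carrier → carrier
  or : carrier → carrier → carrier
  imp : carrier → carrier → carrier
  excl : carrier → carrier → carrier

/-- The interpretation of formulas in an algebra under a valuation `v`. -/
def Alg.eval (A : Alg.{u}) (v : ℕ → A.carrier) : Form → A.carrier
  | .var p => v p
  | .top => A.top
  | .bot => A.bot
  | .and φ ψ => A.and (A.eval v φ) (A.eval v ψ)
  | .or φ ψ => A.or (A.eval v φ) (A.eval v ψ)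
  | .imp φ ψ => A.imp (A.eval v φ) (A.eval v ψ)
  | .excl φ ψ => A.excl (A.eval v φ) (A.eval v ψ)

/-- An equation `φ = ψ` is a pair of formulas. -/
abbrev Equation : Type := Form × Form

/-- The equation holds in the algebra `A` under the valuation `v`. -/
def Alg.Holds (A : Alg.{u}) (v : ℕ → A.carrier) (e : Equation) : Prop :=
  A.eval v e.1 = A.eval v e.2

/-- Equational consequence `Θ ⊨ e` over a class `K` of algebras. -/
def EqConsequence (K : Set Alg.{u}) (Θ : Set Equation) (e : Equation) : Prop :=
  ∀ A ∈ K, ∀ v : ℕ → A.carrier, (∀ e' ∈ Θ, A.Holds v e') → A.Holds v e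

/-- All equations of `τ` are equations in the one variable `x`. -/
def InOneVar (x : ℕ) (τ : Set Equation) : Prop :=
  ∀ e ∈ τ, e.1.vars ⊆ {x} ∧ e.2.vars ⊆ {x}

/-- `τ(φ)`: the equations of `τ(x)` with `x` replaced by `φ`. -/
def tauForm (x : ℕ) (τ : Set Equation) (φ : Form) : Set Equation :=
  {e | ∃ e' ∈ τ, e = (Form.replace x e'.1 φ, Form.replace x e'.2 φ)}

/-- `τ(Γ)`: the union of the sets `τ(γ)` for `γ ∈ Γ`. -/
def tauSet (x : ℕ) (τ : Set Equation) (Γ : Set Form) : Set Equation :=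
  ⋃ γ ∈ Γ, tauForm x τ γ

/-- For a set `τ(x)` of equations in the one variable `x`, the class `K` is a
`τ(x)`-algebraic semantics for the consequence relation `L`:
`Γ ⊢ φ` if and only if `τ(Γ) ⊨ τ(φ)` over `K`, for all `Γ` and `φ`. -/
def IsAlgebraicSemantics (L : Set Form → Form → Prop) (K : Set Alg.{u})
    (x : ℕ) (τ : Set Equation) : Prop :=
  ∀ (Γ : Set Form) (φ : Form),
    L Γ φ ↔ ∀ e ∈ tauForm x τ φ, EqConsequence K (tauSet x τ Γ) e

/-- A bi-Heyting algebra as an algebra of the bi-intuitionistic type. -/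
def algOfBiheyting (X : Type u) [BiheytingAlgebra X] : Alg.{u} where
  carrier := X
  top := ⊤
  bot := ⊥
  and a b := a ⊓ b
  or a b := a ⊔ b
  imp a b := a ⇨ b
  excl a b := a \ b

/-- The class of all bi-Heyting algebras (in the universe `u`). -/
def BHA : Set Alg.{u} :=
  {A | ∃ (X : Type u) (_ : BiheytingAlgebra X), A = algOfBiheyting X}

end BiInt

namespace BiInt

open Form

/-! Suppose `τ` works. As `⊥` is not a theorem, some equation `δ = ε` of `τ` fails at `⊥` in the
subalgebra `{⊥, ⊤}`. On the other hand, `τ(x)` forces `δ ↔ ε`, hence each `(¬∼)ⁿ(δ ↔ ε)`, to take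
the value `⊤`; since `⊤` is a theorem, `τ(⊤)` is valid, so `x ⊢ (¬∼)ⁿ(δ ↔ ε)` for every `n`. But
`wBIL` is sound for the order: the value of `x` must lie below that of `(¬∼)ⁿ(δ ↔ ε)`. This fails
for the lower sets of an infinite fence with `x` true only at its end point: `(¬∼)ⁿ` carries truth
`n` steps along the fence, while far out `x` looks like `⊥` and `δ ↔ ε` is false. -/

theorem himp_himp_le_himp_himp {X : Type u} [HeytingAlgebra X] (p q r : X) :
    p ⇨ q ⇨ r ≤ (p ⇨ q) ⇨ p ⇨ r := by
  rw [le_himp_iff, le_himp_iff]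
  have h1 : (p ⇨ q ⇨ r) ⊓ (p ⇨ q) ⊓ p ≤ q :=
    (inf_le_inf_right _ inf_le_right).trans himp_inf_le
  have h2 : (p ⇨ q ⇨ r) ⊓ (p ⇨ q) ⊓ p ≤ q ⇨ r :=
    (inf_le_inf_right _ inf_le_left).trans himp_inf_le
  exact (le_inf h2 h1).trans himp_inf_le

theorem sdiff_le_top_sdiff_himp {X : Type u} [BiheytingAlgebra X] (p q : X) :
    p \ q ≤ ⊤ \ (p ⇨ q) := by
  rw [sdiff_le_iff]
  have h1 : (p ⇨ q) ⊔ ((⊤ : X) \ (p ⇨ q)) = ⊤ := top_le_iff.1 (sdiff_le_iff.1 le_rfl)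
  calc p = p ⊓ ((p ⇨ q) ⊔ ((⊤ : X) \ (p ⇨ q))) := by rw [h1, inf_top_eq]
    _ = p ⊓ (p ⇨ q) ⊔ p ⊓ ((⊤ : X) \ (p ⇨ q)) := inf_sup_left _ _ _
    _ ≤ q ⊔ (⊤ : X) \ (p ⇨ q) := sup_le_sup inf_himp_le inf_le_right

theorem compl_sdiff_le_himp {X : Type u} [BiheytingAlgebra X] (p q : X) :
    p \ q ⇨ ⊥ ≤ p ⇨ q := by
  rw [le_himp_iff]
  calc (p \ q ⇨ ⊥) ⊓ p ≤ (p \ q ⇨ ⊥) ⊓ (q ⊔ p \ q) :=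
        inf_le_inf_left _ (sdiff_le_iff.1 le_rfl)
    _ = (p \ q ⇨ ⊥) ⊓ q ⊔ (p \ q ⇨ ⊥) ⊓ (p \ q) := inf_sup_left _ _ _
    _ ≤ q := sup_le inf_le_right (himp_inf_le.trans bot_le)

/-- Soundness of `wBIL` for the order-preserving consequence of bi-Heyting algebras: a lower
bound of the premises is a lower bound of the conclusion. -/
theorem WBIL.sound {Γ : Set Form} {φ : Form} (h : WBIL Γ φ) {X : Type u} [BiheytingAlgebra X]
    (v : ℕ → X) (a : X) (ha : ∀ γ ∈ Γ, a ≤ (algOfBiheyting X).eval v γ) :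
    a ≤ (algOfBiheyting X).eval v φ := by
  induction h generalizing a with
  | ax Γ φ h =>
    refine le_trans le_top (top_le_iff.2 ?_)
    cases h <;> simp only [Alg.eval, algOfBiheyting, neg, coneg, himp_eq_top_iff]
    case a1 φ ψ => exact le_himp
    case a2 => exact himp_himp_le_himp_himp _ _ _
    case a3 => exact le_sup_left
    case a4 => exact le_sup_right
    case a5 => rw [le_himp_iff, sup_himp_distrib]
    case a6 => exact inf_le_left
    case a7 => exact inf_le_right
    case a8 => rw [le_himp_iff, himp_inf_distrib]
    case a9 => exact bot_le
    case a10 => exact le_top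
    case a11 => rw [← sdiff_le_iff]
    case a12 => exact sdiff_le_top_sdiff_himp _ _
    case a13 => rw [sdiff_sdiff_left]
    case a14 => exact compl_sdiff_le_himp _ _
  | el Γ φ h => exact ha φ h
  | mp Γ φ ψ _ _ ih₁ ih₂ =>
    exact (le_inf (ih₂ a ha) (ih₁ a ha)).trans himp_inf_le
  | wDN Γ φ _ ih =>
    -- The premise has no assumptions, so the bound `⊤` is available whatever `a` is.
    have h1 := top_le_iff.1 (ih ⊤ (by simp))
    have h2 : (algOfBiheyting X).eval v (neg (coneg φ))
        = ((⊤ : X) \ (algOfBiheyting X).eval v φ) ⇨ (⊥ : X) := rfl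
    rw [h2, h1, sdiff_self, himp_self]
    exact le_top

theorem WBIL.top_intro (Γ : Set Form) : WBIL Γ top :=
  .mp Γ _ _ (.ax Γ _ (.a9 bot)) (.ax Γ _ (.a10 _))

/-! ### Two-valued evaluation and substitution -/

/-- Evaluation of a formula in the two-element algebra with every variable false. -/
def holdsAtBot : Form → Prop
  | .var _ => False
  | .top => True
  | .bot => False
  | .and φ ψ => holdsAtBot φ ∧ holdsAtBot ψ
  | .or φ ψ => holdsAtBot φ ∨ holdsAtBot ψ
  | .imp φ ψ => holdsAtBot φ → holdsAtBot ψ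
  | .excl φ ψ => holdsAtBot φ ∧ ¬ holdsAtBot ψ

/-- The subalgebra `{⊥, ⊤}` of any bi-Heyting algebra evaluates formulas classically. -/
theorem eval_replace_bot {X : Type u} [BiheytingAlgebra X] (v : ℕ → X) (x : ℕ) (φ : Form)
    (hφ : φ.vars ⊆ {x}) :
    (holdsAtBot φ → (algOfBiheyting X).eval v (replace x φ bot) = (⊤ : X)) ∧
      (¬ holdsAtBot φ → (algOfBiheyting X).eval v (replace x φ bot) = (⊥ : X)) := by
  induction φ with
  | var p =>
    have hp : p = x := by simpa [vars] using hφ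
    simp [holdsAtBot, replace, hp, Alg.eval, algOfBiheyting]
  | top => simp [holdsAtBot, replace, Alg.eval, algOfBiheyting]
  | bot => simp [holdsAtBot, replace, Alg.eval, algOfBiheyting]
  | and φ ψ ih₁ ih₂ | or φ ψ ih₁ ih₂ | imp φ ψ ih₁ ih₂ | excl φ ψ ih₁ ih₂ =>
    simp only [vars, Set.union_subset_iff] at hφ
    specialize ih₁ hφ.1
    specialize ih₂ hφ.2
    simp only [algOfBiheyting] at ih₁ ih₂
    by_cases h₁ : holdsAtBot φ <;> by_cases h₂ : holdsAtBot ψ <;>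
      simp_all [holdsAtBot, replace, Alg.eval, algOfBiheyting]

theorem eval_replace_congr (A : Alg.{u}) (v : ℕ → A.carrier) (x : ℕ) {χ χ' : Form}
    (h : A.eval v χ = A.eval v χ') (φ : Form) :
    A.eval v (replace x φ χ) = A.eval v (replace x φ χ') := by
  induction φ with
  | var p => by_cases hp : p = x <;> simp [replace, hp, h]
  | top => rfl
  | bot => rfl
  | and φ ψ ih₁ ih₂ | or φ ψ ih₁ ih₂ | imp φ ψ ih₁ ih₂ | excl φ ψ ih₁ ih₂ =>
    simp only [replace, Alg.eval, ih₁, ih₂]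

theorem replace_var_self (x : ℕ) (φ : Form) : replace x φ (var x) = φ := by
  induction φ with
  | var p => by_cases hp : p = x <;> simp [replace, hp]
  | top => rfl
  | bot => rfl
  | and φ ψ ih₁ ih₂ | or φ ψ ih₁ ih₂ | imp φ ψ ih₁ ih₂ | excl φ ψ ih₁ ih₂ =>
    simp only [replace, ih₁, ih₂]

/-- The biconditional of two formulas. -/
def biimp (φ ψ : Form) : Form := and (imp φ ψ) (imp ψ φ)

theorem eval_biimp_eq_top {X : Type u} [BiheytingAlgebra X] {v : ℕ → X} {φ ψ : Form}
    (h : (algOfBiheyting X).eval v φ = (algOfBiheyting X).eval v ψ) :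
    (algOfBiheyting X).eval v (biimp φ ψ) = (⊤ : X) := by
  have himp_inf_himp {a b : X} (hab : a = b) : (a ⇨ b) ⊓ (b ⇨ a) = ⊤ := by simp [hab]
  exact himp_inf_himp h

/-- The formula `¬∼⋯¬∼φ` with `n` occurrences of `¬∼`. -/
def negConeg (n : ℕ) (φ : Form) : Form := (fun ψ => neg (coneg ψ))^[n] φ

theorem negConeg_succ (n : ℕ) (φ : Form) :
    negConeg (n + 1) φ = neg (coneg (negConeg n φ)) :=
  Function.iterate_succ_apply' _ _ _

theorem eval_negConeg_eq_top {X : Type u} [BiheytingAlgebra X] {v : ℕ → X} {φ : Form}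
    (h : (algOfBiheyting X).eval v φ = (⊤ : X)) (n : ℕ) :
    (algOfBiheyting X).eval v (negConeg n φ) = (⊤ : X) := by
  induction n with
  | zero => exact h
  | succ n ih =>
    have h2 : (algOfBiheyting X).eval v (neg (coneg (negConeg n φ)))
        = ((⊤ : X) \ (algOfBiheyting X).eval v (negConeg n φ)) ⇨ (⊥ : X) := rfl
    rw [negConeg_succ, h2, ih, sdiff_self, himp_self]

/-! ### Kripke semantics on lower sets -/

section LowerSets

variable {α : Type u} [PartialOrder α]

theorem mem_himp_lowerSet {s t : LowerSet α} {a : α} :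
    a ∈ s ⇨ t ↔ ∀ b ≤ a, b ∈ s → b ∈ t := by
  rw [← LowerSet.Iic_le, le_himp_iff]
  exact ⟨fun h b hb hs => h ⟨hb, hs⟩, fun h b hb => h b hb.1 hb.2⟩

theorem mem_sdiff_lowerSet {s t : LowerSet α} {a : α} :
    a ∈ s \ t ↔ ∃ b, a ≤ b ∧ b ∈ s ∧ b ∉ t := by
  constructor
  -- `r` is the down-closure of the set difference; it satisfies `s ≤ t ⊔ r`, so it bounds `s \ t`
  -- by adjunction.
  · let r : LowerSet α := ⟨{a | ∃ b, a ≤ b ∧ b ∈ s ∧ b ∉ t},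
      fun _ _ hyx ⟨b, hb, h⟩ => ⟨b, hyx.trans hb, h⟩⟩
    have h : s \ t ≤ r := sdiff_le_iff.2 fun b hb => by
      by_cases hbt : b ∈ t
      · exact Or.inl hbt
      · exact Or.inr ⟨b, le_rfl, hb, hbt⟩
    exact fun ha => h ha
  · rintro ⟨b, hab, hs, ht⟩
    have h : s ≤ t ⊔ s \ t := sdiff_le_iff.1 le_rfl
    exact (s \ t).lower hab ((h hs).resolve_left ht)

end LowerSets

/-! ### The infinite fence -/

/-- The infinite fence `0 < 1 > 2 < 3 > ⋯`. -/
structure Fence : Type u where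
  idx : ℕ

instance : PartialOrder Fence.{u} where
  le a b := a = b ∨ (Even a.idx ∧ (b.idx = a.idx + 1 ∨ a.idx = b.idx + 1))
  le_refl a := Or.inl rfl
  le_trans := by
    rintro a b c (rfl | ⟨h, h'⟩) (rfl | ⟨k, k'⟩)
    · exact Or.inl rfl
    · exact Or.inr ⟨k, k'⟩
    · exact Or.inr ⟨h, h'⟩
    -- Impossible case: neighbours have opposite parity, so `a` and `b` are not both even.
    · grind
  le_antisymm := by
    rintro a b (rfl | ⟨h, h'⟩) (k | ⟨k, k'⟩)
    · rfl
    · rfl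
    · exact k.symm
    · grind

theorem Fence.le_def {a b : Fence.{u}} :
    a ≤ b ↔ a = b ∨ (Even a.idx ∧ (b.idx = a.idx + 1 ∨ a.idx = b.idx + 1)) := Iff.rfl

theorem Fence.idx_le_succ_of_le {a b : Fence.{u}} (h : a ≤ b) :
    a.idx ≤ b.idx + 1 ∧ b.idx ≤ a.idx + 1 := by
  rcases h with rfl | ⟨_, h⟩ <;> omega

theorem Fence.le_succ_or_succ_le (k : ℕ) :
    (⟨k⟩ : Fence.{u}) ≤ ⟨k + 1⟩ ∨ (⟨k + 1⟩ : Fence.{u}) ≤ ⟨k⟩ := by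
  simp only [Fence.le_def]
  grind

/-- The valuation that makes every variable true exactly at the point `0` of the fence. -/
def fenceVal (_ : ℕ) : LowerSet Fence.{u} := LowerSet.Iic ⟨0⟩

/-- The value of a formula on the fence. -/
def fenceEval (φ : Form) : LowerSet Fence.{u} :=
  (algOfBiheyting (LowerSet Fence.{u})).eval fenceVal φ

/-- Far out on the fence a formula has its classical value with every variable false. -/
theorem mem_fenceEval_eventually (φ : Form) :
    ∃ N : ℕ, ∀ a : Fence.{u}, N ≤ a.idx → (a ∈ fenceEval φ ↔ holdsAtBot φ) := by
  induction φ with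
  | var p =>
    refine ⟨2, fun a ha => iff_of_false (fun h => ?_) not_false⟩
    have h : a ≤ ⟨0⟩ := h
    have := (Fence.idx_le_succ_of_le h).1
    simp only at this
    omega
  | top => exact ⟨0, fun a _ => iff_of_true (LowerSet.mem_top) trivial⟩
  | bot => exact ⟨0, fun a _ => iff_of_false (LowerSet.notMem_bot) not_false⟩
  | and φ ψ ih₁ ih₂ =>
    obtain ⟨M, hM⟩ := ih₁
    obtain ⟨N, hN⟩ := ih₂
    exact ⟨max M N, fun a ha =>
      and_congr (hM a (le_of_max_le_left ha)) (hN a (le_of_max_le_right ha))⟩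
  | or φ ψ ih₁ ih₂ =>
    obtain ⟨M, hM⟩ := ih₁
    obtain ⟨N, hN⟩ := ih₂
    exact ⟨max M N, fun a ha =>
      or_congr (hM a (le_of_max_le_left ha)) (hN a (le_of_max_le_right ha))⟩
  | imp φ ψ ih₁ ih₂ =>
    obtain ⟨M, hM⟩ := ih₁
    obtain ⟨N, hN⟩ := ih₂
    -- The connective inspects points comparable to `a`, whose indices differ from that of `a` by at
    -- most one; hence the `+ 1`.
    refine ⟨max M N + 1, fun a ha => mem_himp_lowerSet.trans ⟨fun h => ?_, fun h b hb => ?_⟩⟩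
    · exact fun h₁ => (hN a (by omega)).1 (h a le_rfl ((hM a (by omega)).2 h₁))
    · have := (Fence.idx_le_succ_of_le hb).2
      exact fun h₁ => (hN b (by omega)).2 (h ((hM b (by omega)).1 h₁))
  | excl φ ψ ih₁ ih₂ =>
    obtain ⟨M, hM⟩ := ih₁
    obtain ⟨N, hN⟩ := ih₂
    refine ⟨max M N + 1, fun a ha => mem_sdiff_lowerSet.trans ⟨?_, fun h => ?_⟩⟩
    · rintro ⟨b, hb, h₁, h₂⟩
      have := (Fence.idx_le_succ_of_le hb).1
      exact ⟨(hM b (by omega)).1 h₁, fun h => h₂ ((hN b (by omega)).2 h)⟩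
    · exact ⟨a, le_rfl, (hM a (by omega)).2 h.1, fun h' => h.2 ((hN a (by omega)).1 h')⟩

/-- Negation quantifies over points below and co-negation over points above, so `¬∼` is a box along
"down, then up". -/
theorem mem_of_mem_fenceEval_neg_coneg {φ : Form} {a b c : Fence.{u}}
    (h : a ∈ fenceEval (neg (coneg φ))) (hba : b ≤ a) (hbc : b ≤ c) : c ∈ fenceEval φ := by
  by_contra hc
  have h' : b ∈ (⊥ : LowerSet Fence.{u}) :=
    mem_himp_lowerSet.1 (show a ∈ ((⊤ : LowerSet Fence.{u}) \ fenceEval φ) ⇨ ⊥ from h) b hba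
      (mem_sdiff_lowerSet.2 ⟨c, hbc, LowerSet.mem_top, hc⟩)
  exact LowerSet.notMem_bot h'

/-- Each `¬∼` pays for one edge of the fence, whichever way the edge points. -/
theorem mem_fenceEval_of_negConeg {φ : Form} (n k : ℕ)
    (h : (⟨k⟩ : Fence.{u}) ∈ fenceEval (negConeg n φ)) :
    (⟨k + n⟩ : Fence.{u}) ∈ fenceEval φ := by
  induction n generalizing k with
  | zero => exact h
  | succ n ih =>
    rw [negConeg_succ] at h
    have h' : (⟨k + 1⟩ : Fence.{u}) ∈ fenceEval (negConeg n φ) := by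
      rcases Fence.le_succ_or_succ_le.{u} k with hk | hk
      · exact mem_of_mem_fenceEval_neg_coneg h le_rfl hk
      · exact mem_of_mem_fenceEval_neg_coneg h hk le_rfl
    have := ih (k + 1) h'
    rwa [show k + 1 + n = k + (n + 1) by omega] at this

/-- Some equation of a `τ(x)`-algebraic semantics fails at `⊥` in the two-element algebra. -/
theorem IsAlgebraicSemantics.exists_not_holdsAtBot_biimp {x : ℕ} {τ : Set Equation}
    (hx : InOneVar x τ) (h : IsAlgebraicSemantics WBIL BHA.{u} x τ) :
    ∃ e ∈ τ, ¬ holdsAtBot (biimp e.1 e.2) := by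
  by_contra! hτ
  have hbot : WBIL ∅ bot := by
    refine (h ∅ bot).2 ?_
    rintro _ ⟨e, he, rfl⟩ _ ⟨X, _, rfl⟩ v -
    have hT : (holdsAtBot e.1 → holdsAtBot e.2) ∧ (holdsAtBot e.2 → holdsAtBot e.1) := hτ e he
    have h₁ := eval_replace_bot (X := X) v x e.1 (hx e he).1
    have h₂ := eval_replace_bot (X := X) v x e.2 (hx e he).2
    by_cases hb : holdsAtBot e.1
    · exact (h₁.1 hb).trans (h₂.1 (hT.1 hb)).symm
    · exact (h₁.2 hb).trans (h₂.2 fun h' => hb (hT.2 h')).symm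
  -- In `Prop`, soundness gives `⊤ ≤ ⊥`, that is `True → False`.
  exact WBIL.sound hbot (X := Prop) (fun _ => ⊥) ⊤ (by simp) trivial

/-- The premise `x` derives every `¬∼⋯¬∼(δ ↔ ε)` for an equation `δ = ε` of `τ(x)`. -/
theorem IsAlgebraicSemantics.wbil_negConeg_biimp {x : ℕ} {τ : Set Equation}
    (h : IsAlgebraicSemantics WBIL BHA.{u} x τ) {e : Equation} (he : e ∈ τ) (n : ℕ) :
    WBIL {var x} (negConeg n (biimp e.1 e.2)) := by
  refine (h _ _).2 ?_
  rintro _ ⟨e', he', rfl⟩ _ ⟨X, _, rfl⟩ v hv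
  have hev : (algOfBiheyting X).eval v e.1 = (algOfBiheyting X).eval v e.2 := by
    refine hv e (Set.mem_biUnion (Set.mem_singleton (var x)) ⟨e, he, ?_⟩)
    simp only [replace_var_self]
  have hT := eval_biimp_eq_top hev
  have hχ : (algOfBiheyting X).eval v (negConeg n (biimp e.1 e.2)) =
      (algOfBiheyting X).eval v top := eval_negConeg_eq_top hT n
  -- Validity of `τ(⊤)` transfers to any formula with value `⊤`.
  have htop := (h ∅ top).1 (WBIL.top_intro ∅) _ ⟨e', he', rfl⟩ _ ⟨X, _, rfl⟩ v
    (by simp [tauSet])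
  exact (eval_replace_congr _ v x hχ e'.1).trans
    (htop.trans (eval_replace_congr _ v x hχ e'.2).symm)

end BiInt

theorem mainTheorem6 :
    ¬ ∃ (x : ℕ) (τ : Set BiInt.Equation),
      BiInt.InOneVar x τ ∧ BiInt.IsAlgebraicSemantics BiInt.WBIL BiInt.BHA.{u} x τ := by
  rintro ⟨x, τ, hx, h⟩
  obtain ⟨e, he, hbot⟩ := h.exists_not_holdsAtBot_biimp hx
  obtain ⟨N, hN⟩ := BiInt.mem_fenceEval_eventually.{u} (BiInt.biimp e.1 e.2)
  have hle : LowerSet.Iic (⟨0⟩ : BiInt.Fence.{u}) ≤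
      BiInt.fenceEval (BiInt.negConeg N (BiInt.biimp e.1 e.2)) :=
    (h.wbil_negConeg_biimp he N).sound BiInt.fenceVal _ (by
      rintro _ rfl
      exact le_rfl)
  have hmem := BiInt.mem_fenceEval_of_negConeg N 0 (hle (LowerSet.mem_Iic_iff.2 le_rfl))
  exact hbot ((hN _ (by simp)).1 hmem)
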